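/- Let $d\ge 1$, $\mathcal U=(-1,1)^d$, let $\varrho$ be the uniform probability measure on $\mathcal U$, and let $\boldsymbol\rho=(\rho_1,\dots,\rho_d)$ with $\rho_j>1$ for all $j$. Let $\mathcal E_{\rho}=\{(z+z^{-1})/2 : z\in\mathbb C,\ 1\le |z|\le \rho\}$ be the (filled, closed) Bernstein ellipse with parameter $\rho>1$ and $\mathcal B_{\boldsymbol\rho}=\mathcal E_{\rho_1}\times\cdots\times\mathcal E_{\rho_d}\subset\mathbb C^d$ the Bernstein polyellipse. For $\boldsymbol\nu\in\mathbb N_0^d$ let $\Psi_{\boldsymbol\nu}(\boldsymbol x)=\prod_{j=1}^d\sqrt{2\nu_j+1}\,P_{\nu_j}(x_j)$, where $P_n$ is the classical Legendre polynomial with $P_n(1)=1$. Let $f:\mathcal U\to\mathbb R$ admit a holomorphic extension to an open set containing $\mathcal B_{\boldsymbol\rho}$, and put $c_{\boldsymbol\nu}=\int_{\mathcal U} f\,\Psi_{\boldsymbol\nu}\,d\varrho$. Then for every integer $s\ge 1$ there is a lower set $\Lambda=\Lambda_s\subset\mathbb N_0^d$ (that is, $\boldsymbol\nu\in\Lambda$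 and $\boldsymbol\mu\le\boldsymbol\nu$ componentwise imply $\boldsymbol\mu\in\Lambda$) with at most $s$ elements such that the following holds. For every $\gamma$ with $$0<\gamma<\frac{1}{d+1}\Bigl(d!\prod_{j=1}^d\log\rho_j\Bigr)^{1/d}$$ there is a constant $C>0$, depending on $d$, $\boldsymbol\rho$, $\gamma$ and $f$ only (in particular not on $s$), such that for all $s\ge 1$ $$\Bigl\|f-\sum_{\boldsymbol\nu\in\Lambda_s}c_{\boldsymbol\nu}\Psi_{\boldsymbol\nu}\Bigr\|_{L^\infty(\mathcal U)}\le C\exp\bigl(-\gamma s^{1/d}\bigr).$$ -/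

import Mathlib

open MeasureTheory Polynomial
open scoped Nat ENNReal

namespace LegendreApprox

/-- The closed (filled) Bernstein ellipse `{(z + z⁻¹) / 2 : 1 ≤ |z| ≤ ρ}`. -/
def bernsteinEllipse (ρ : ℝ) : Set ℂ :=
  {w | ∃ z : ℂ, 1 ≤ ‖z‖ ∧ ‖z‖ ≤ ρ ∧ w = (z + z⁻¹) / 2}

/-- The Bernstein polyellipse, the Cartesian product of the ellipses with parameters `ρ j`. -/
def bernsteinPolyellipse {d : ℕ} (ρ : Fin d → ℝ) : Set (Fin d → ℂ) :=
  Set.univ.pi fun j => bernsteinEllipse (ρ j)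

/-- The open cube `(-1, 1)^d`. -/
def cube (d : ℕ) : Set (Fin d → ℝ) :=
  {x | ∀ j, x j ∈ Set.Ioo (-1 : ℝ) 1}

/-- The uniform probability measure on the cube `(-1, 1)^d`: Lebesgue measure restricted to the
cube and divided by the volume of the cube. -/
noncomputable def uniformMeasure (d : ℕ) : Measure (Fin d → ℝ) :=
  ProbabilityTheory.cond volume (cube d)

/-- `f`, of which only the values on the cube matter, has a holomorphic extension to an open
neighbourhood of the Bernstein polyellipse. For functions on an open subset of `ℂ^d`, holomorphic
means complex differentiable at each point. -/
def HasHolomorphicExtension {d : ℕ} (ρ : Fin d → ℝ) (f : (Fin d → ℝ) → ℝ) : Prop :=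
  ∃ (O : Set (Fin d → ℂ)) (F : (Fin d → ℂ) → ℂ),
    IsOpen O ∧ bernsteinPolyellipse ρ ⊆ O ∧ DifferentiableOn ℂ F O ∧
      ∀ x ∈ cube d, F (fun j => (x j : ℂ)) = (f x : ℂ)

/-- The classical Legendre polynomial `P_n`, with `P_n(1) = 1`, by Rodrigues' formula. -/
noncomputable def legendre (n : ℕ) : ℝ[X] :=
  C ((2 ^ n * (n ! : ℝ))⁻¹) * derivative^[n] ((X ^ 2 - 1) ^ n)

/-- The tensor product orthonormal Legendre polynomial
`Ψ_ν(x) = ∏ j, √(2 ν_j + 1) P_{ν_j}(x_j)`. -/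
noncomputable def tensorLegendre {d : ℕ} (ν : Fin d → ℕ) (x : Fin d → ℝ) : ℝ :=
  ∏ j, √(2 * (ν j : ℝ) + 1) * (legendre (ν j)).eval (x j)

/-- The Legendre coefficient `c_ν` of `f`. -/
noncomputable def legendreCoeff {d : ℕ} (f : (Fin d → ℝ) → ℝ) (ν : Fin d → ℕ) : ℝ :=
  ∫ x, f x * tensorLegendre ν x ∂(uniformMeasure d)

/-- The Legendre expansion of `f` truncated to the finite index set `Λ`. -/
noncomputable def truncatedExpansion {d : ℕ} (f : (Fin d → ℝ) → ℝ) (Λ : Finset (Fin d → ℕ))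
    (x : Fin d → ℝ) : ℝ :=
  ∑ ν ∈ Λ, legendreCoeff f ν * tensorLegendre ν x

end LegendreApprox

/-! Boxes of indices already suffice. With `P = ∏ log ρ_j` and `u = (s P)^(1/d)`, the box `ν_j < ⌊u
/ log ρ_j⌋` has at most `s` elements, and each `ρ_j ^ (-N_j)` is of size `exp (-u)`. The truncation
error is therefore `exp (-u)` times a power of `1 + u`, so every rate below `P^(1/d)` is reached.
Since `(d!)^(1/d) ≤ d < d + 1`, this covers all the admissible `γ`, with sets independent of `γ`.

The error bound for a box rests on three facts. In one variable, Fourier expansion of `F (cos θ)`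
yields polynomials converging at rate `ρ⁻¹` (`exists_polynomial_approx`). The Legendre projection
reproduces polynomials and has a kernel bounded by `N ^ 2`, because `|P_n| ≤ 1`, so it loses only a
polynomial factor (`abs_integral_legendreKernel_sub_le`). The projection onto a box is a tensor
product of one-variable projections, and exchanging coordinates one at a time adds up the
one-variable errors (`abs_integral_prod_kernel_sub_le`). -/

namespace LegendreApprox

/-! ### Legendre polynomials: sup bound, orthogonality and reproducing kernel. -/

section Legendre

/-- The polynomial `(X² - 1)ⁿ` of Rodrigues' formula, differentiated `k` times. -/
noncomputable def rodrigues (n k : ℕ) : ℝ[X] := derivative^[k] ((X ^ 2 - 1) ^ n)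

theorem legendre_eq (n : ℕ) : legendre n = C ((2 ^ n * (n ! : ℝ))⁻¹) * rodrigues n n := rfl

theorem derivative_rodrigues (n k : ℕ) : derivative (rodrigues n k) = rodrigues n (k + 1) := by
  simp only [rodrigues, Function.iterate_succ_apply']

/-- Repeated differentiation of `(X² - 1) r' = 2 n X r` for `r = (X² - 1)ⁿ`. The case `k = n` is
Legendre's equation. -/
theorem rodrigues_ode (n k : ℕ) :
    (X ^ 2 - 1) * rodrigues n (k + 2) + C (2 * ((k : ℝ) + 1) - 2 * n) * X * rodrigues n (k + 1)
      + C (((k : ℝ) + 1) * k - 2 * n * (k + 1)) * rodrigues n k = 0 := by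
  induction k with
  | zero =>
    have h : (X ^ 2 - 1) * rodrigues n 1 = C (2 * (n : ℝ)) * X * rodrigues n 0 := by
      rw [← derivative_rodrigues]
      simp only [rodrigues, Function.iterate_zero, id]
      rcases n with _ | n
      · simp
      · simp only [derivative_pow, derivative_sub, derivative_one, derivative_X, map_mul,
          map_natCast, Nat.add_sub_cancel, map_ofNat]
        push_cast
        ring
    have h2 := congrArg derivative h
    simp only [derivative_mul, derivative_sub, derivative_one, derivative_X, derivative_X_pow,
      derivative_C, derivative_rodrigues] at h2
    simp only [map_mul, map_sub, map_add, map_natCast, map_ofNat, map_one] at h2 ⊢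
    push_cast at h2 ⊢
    linear_combination h2
  | succ k ih =>
    have h2 := congrArg derivative ih
    simp only [derivative_mul, derivative_sub, derivative_add, derivative_one, derivative_X,
      derivative_X_pow, derivative_C, derivative_rodrigues, derivative_zero] at h2
    simp only [map_mul, map_sub, map_add, map_natCast, map_ofNat, map_one] at h2 ⊢
    push_cast at h2 ⊢
    linear_combination h2

theorem legendre_ode (n : ℕ) (x : ℝ) :
    (x ^ 2 - 1) * (derivative (derivative (legendre n))).eval x
      + 2 * x * (derivative (legendre n)).eval x
      = n * (n + 1) * (legendre n).eval x := by
  have h := congrArg (eval x) (rodrigues_ode n n)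
  simp only [eval_add, eval_mul, eval_sub, eval_pow, eval_X, eval_one, eval_C, eval_zero] at h
  simp only [legendre_eq, derivative_C_mul, derivative_rodrigues, eval_mul, eval_C]
  linear_combination ((2 ^ n * (n ! : ℝ))⁻¹) * h

/-- In the Leibniz rule for `(X - 1)ⁿ (X + 1)ⁿ`, only the term with all derivatives on the vanishing
factor survives. -/
theorem rodrigues_eval_one (n : ℕ) : (rodrigues n n).eval 1 = 2 ^ n * (n ! : ℝ) := by
  have h : ((X : ℝ[X]) ^ 2 - 1) ^ n = (X - C 1) ^ n * (X + C 1) ^ n := by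
    rw [← mul_pow]; congr 1; simp; ring
  rw [rodrigues, h, iterate_derivative_mul, eval_finsetSum, Finset.sum_eq_single 0]
  · rw [Nat.sub_zero, iterate_derivative_X_sub_pow_self]
    simp
    norm_num [mul_comm]
  · intro k hk hk0
    rw [iterate_derivative_X_sub_pow]
    have : n - (n - k) ≠ 0 := by
      have := Finset.mem_range.1 hk
      omega
    simp [this]
  · simp

theorem rodrigues_eval_neg_one (n : ℕ) :
    (rodrigues n n).eval (-1) = (-1) ^ n * (2 ^ n * (n ! : ℝ)) := by
  have h : ((X : ℝ[X]) ^ 2 - 1) ^ n = (X - C (-1)) ^ n * (X - C 1) ^ n := by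
    rw [← mul_pow]; congr 1; simp; ring
  rw [rodrigues, h, iterate_derivative_mul, eval_finsetSum, Finset.sum_eq_single 0]
  · rw [Nat.sub_zero, iterate_derivative_X_sub_pow_self]
    simp
    norm_num
    rw [show (-2 : ℝ) = (-1) * 2 by norm_num, mul_pow]
    ring
  · intro k hk hk0
    rw [iterate_derivative_X_sub_pow]
    have : n - (n - k) ≠ 0 := by
      have := Finset.mem_range.1 hk
      omega
    simp only [eval_smul, eval_mul, eval_pow, eval_sub, eval_X, eval_C, sub_self, zero_pow this,
      smul_zero, zero_mul]
  · simp

theorem legendre_eval_one (n : ℕ) : (legendre n).eval 1 = 1 := by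
  rw [legendre_eq, eval_mul, eval_C, rodrigues_eval_one, inv_mul_cancel₀ (by positivity)]

theorem legendre_eval_neg_one (n : ℕ) : (legendre n).eval (-1) = (-1) ^ n := by
  rw [legendre_eq, eval_mul, eval_C, rodrigues_eval_neg_one, mul_left_comm,
    inv_mul_cancel₀ (by positivity), mul_one]

/-- The Legendre polynomials are bounded by `1` on `[-1, 1]`. -/
theorem abs_legendre_eval_le_one (n : ℕ) {x : ℝ} (hx : x ∈ Set.Icc (-1 : ℝ) 1) :
    |(legendre n).eval x| ≤ 1 := by
  rcases Nat.eq_zero_or_pos n with rfl | hn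
  · simp [legendre]
  set P := legendre n
  have hn' : (0 : ℝ) < n * (n + 1) := by positivity
  -- Sonin's function: by Legendre's equation `E' = 2 y P'²`, so `E` grows with `|y|` and is at most
  -- its endpoint value `n (n + 1)`.
  let E : ℝ[X] := C ((n : ℝ) * (n + 1)) * P ^ 2 + (1 - X ^ 2) * (derivative P) ^ 2
  have hE : ∀ y, E.eval y = n * (n + 1) * (P.eval y) ^ 2
      + (1 - y ^ 2) * ((derivative P).eval y) ^ 2 := by
    intro y; simp [E]
  have hE' : ∀ y, HasDerivAt (fun y => E.eval y) (2 * y * ((derivative P).eval y) ^ 2) y := by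
    intro y
    have h := legendre_ode n y
    have hd : (derivative E).eval y = 2 * y * ((derivative P).eval y) ^ 2 := by
      simp only [E, derivative_add, derivative_mul, derivative_C, derivative_pow, derivative_sub,
        derivative_one, derivative_X, eval_add, eval_mul, eval_sub, eval_pow, eval_C, eval_one,
        eval_X, eval_zero]
      push_cast
      linear_combination (-2 * (derivative P).eval y) * h
    exact hd ▸ E.hasDerivAt y
  have hcont : Continuous fun y => E.eval y := E.continuous
  have key : E.eval x ≤ n * (n + 1) := by
    rcases le_total 0 x with h0 | h0
    · have : MonotoneOn (fun y => E.eval y) (Set.Icc 0 1) := by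
        refine monotoneOn_of_deriv_nonneg (convex_Icc 0 1) hcont.continuousOn
          (fun y _ => (hE' y).differentiableAt.differentiableWithinAt) fun y hy => ?_
        rw [interior_Icc] at hy
        rw [(hE' y).deriv]
        have := hy.1
        positivity
      have h := this ⟨h0, hx.2⟩ (Set.right_mem_Icc.2 zero_le_one) hx.2
      simpa [hE, P, legendre_eval_one] using h
    · have : AntitoneOn (fun y => E.eval y) (Set.Icc (-1) 0) := by
        refine antitoneOn_of_deriv_nonpos (convex_Icc (-1) 0) hcont.continuousOn
          (fun y _ => (hE' y).differentiableAt.differentiableWithinAt) fun y hy => ?_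
        rw [interior_Icc] at hy
        rw [(hE' y).deriv]
        nlinarith [hy.2, sq_nonneg ((derivative P).eval y)]
      have h := this (Set.left_mem_Icc.2 (by norm_num)) ⟨hx.1, h0⟩ hx.1
      simpa [hE, P, legendre_eval_neg_one, ← pow_mul, mul_comm _ 2] using h
  have hx2 : 0 ≤ (1 - x ^ 2) * ((derivative P).eval x) ^ 2 :=
    mul_nonneg (by nlinarith [hx.1, hx.2]) (sq_nonneg _)
  rw [hE] at key
  have : (P.eval x) ^ 2 ≤ 1 := by
    by_contra! hc
    nlinarith
  rwa [sq_le_one_iff_abs_le_one] at this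

theorem integral_derivative_eval (p : ℝ[X]) (a b : ℝ) :
    ∫ x in a..b, (derivative p).eval x = p.eval b - p.eval a :=
  intervalIntegral.integral_eq_sub_of_hasDerivAt (fun x _ => p.hasDerivAt x)
    ((derivative p).continuous.intervalIntegrable _ _)

theorem intervalIntegrable_eval (p : ℝ[X]) (a b : ℝ) :
    IntervalIntegrable (fun x => p.eval x) volume a b :=
  p.continuous.intervalIntegrable _ _

theorem integral_derivative_mul_eval (p q : ℝ[X]) (a b : ℝ) :
    ∫ x in a..b, (derivative p * q).eval x =
      (p * q).eval b - (p * q).eval a - ∫ x in a..b, (p * derivative q).eval x := by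
  have h := integral_derivative_eval (p * q) a b
  simp only [derivative_mul, eval_add] at h
  rw [intervalIntegral.integral_add (intervalIntegrable_eval _ _ _)
    (intervalIntegrable_eval _ _ _)] at h
  linarith

theorem rodrigues_eval_eq_zero {n k : ℕ} (hk : k < n) {x : ℝ} (hx : x ^ 2 = 1) :
    (rodrigues n k).eval x = 0 := by
  have h : ((X : ℝ[X]) ^ 2 - 1) ^ (n - k) ∣ rodrigues n k :=
    pow_sub_dvd_iterate_derivative_of_pow_dvd k dvd_rfl
  obtain ⟨q, hq⟩ := h
  rw [hq]
  simp [hx, Nat.sub_ne_zero_of_lt hk]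

/-- Each integration by parts lowers the degree of `q`, and the boundary terms vanish because `X² -
1` divides the lower derivatives. A general `k` is needed for the induction. -/
theorem integral_rodrigues_mul_eq_zero {n k : ℕ} (hk : k ≤ n) {q : ℝ[X]} (hq : q.degree < k) :
    ∫ x in (-1 : ℝ)..1, (rodrigues n k * q).eval x = 0 := by
  induction k generalizing q with
  | zero =>
    have : q = 0 := by simpa using hq
    simp [this]
  | succ k ih =>
    rw [← derivative_rodrigues, integral_derivative_mul_eval, ih (by omega)]
    · simp [rodrigues_eval_eq_zero (show k < n by omega)]
    · by_cases h0 : q = 0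
      · simp [h0]
      · by_cases h1 : derivative q = 0
        · simp [h1]
        · rw [degree_eq_natDegree h0] at hq
          have : q.natDegree ≠ 0 := fun h => h1 (by
            rw [eq_C_of_natDegree_eq_zero h, derivative_C])
          rw [degree_eq_natDegree h1]
          have h2 := natDegree_derivative_lt this
          norm_cast at hq ⊢
          omega

/-- `P_n` is orthogonal to all polynomials of degree less than `n`. -/
theorem integral_legendre_mul_eq_zero {n : ℕ} {q : ℝ[X]} (hq : q.degree < n) :
    ∫ x in (-1 : ℝ)..1, (legendre n * q).eval x = 0 := by
  simp only [legendre_eq, mul_assoc, eval_C_mul (R := ℝ)]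
  rw [intervalIntegral.integral_const_mul, integral_rodrigues_mul_eq_zero le_rfl hq, mul_zero]

theorem degree_legendre_le (n : ℕ) : (legendre n).degree ≤ n := by
  rw [← natDegree_le_iff_degree_le, legendre_eq]
  refine (natDegree_C_mul_le _ _).trans ((natDegree_iterate_derivative _ _).trans ?_)
  have : ((X : ℝ[X]) ^ 2 - 1).natDegree ≤ 2 := by compute_degree
  have h2 := natDegree_pow_le_of_le n this
  omega

theorem degree_X_mul_derivative_sub_lt {n : ℕ} {p : ℝ[X]} (hp : p.degree ≤ n) :
    (X * derivative p - C (n : ℝ) * p).degree < (n : WithBot ℕ) := by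
  rw [degree_lt_iff_coeff_zero]
  intro m hm
  rcases hm.eq_or_lt with rfl | hm
  · rcases n with _ | n
    · simp
    · rw [coeff_sub, coeff_X_mul, coeff_derivative, coeff_C_mul]
      push_cast
      ring
  · have h1 : p.coeff m = 0 := coeff_eq_zero_of_degree_lt (hp.trans_lt (by exact_mod_cast hm))
    rcases m with _ | m
    · omega
    · simp [coeff_X_mul, coeff_derivative, h1]

/-- The polynomial `X P' - n P` has degree below `n`, hence is orthogonal to `P`. Integrating `x
(P²)'` by parts then gives a linear equation for `∫ P²`. -/
theorem integral_legendre_sq (n : ℕ) :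
    ∫ x in (-1 : ℝ)..1, (legendre n * legendre n).eval x = 2 / (2 * n + 1) := by
  set P := legendre n
  have h0 := integral_legendre_mul_eq_zero (degree_X_mul_derivative_sub_lt (degree_legendre_le n))
  have h1 := integral_derivative_mul_eval X (P * P) (-1) 1
  have h2 : ∀ x, (P * (X * derivative P - C (n : ℝ) * P)).eval x =
      (1 / 2) * (X * derivative (P * P)).eval x - n * (P * P).eval x := by
    intro x
    simp [derivative_mul]
    ring
  simp only [h2, P] at h0
  rw [intervalIntegral.integral_sub ((intervalIntegrable_eval _ _ _).const_mul _)
    ((intervalIntegrable_eval _ _ _).const_mul _), intervalIntegral.integral_const_mul,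
    intervalIntegral.integral_const_mul] at h0
  have h3 : (X * (P * P)).eval 1 - (X * (P * P)).eval (-1) = 2 := by
    simp [P, legendre_eval_one, legendre_eval_neg_one, ← mul_pow]
    norm_num
  rw [h3, derivative_X, one_mul] at h1
  rw [eq_div_iff (by positivity)]
  linarith

/-- A smaller degree would make `P_n` orthogonal to itself. -/
theorem degree_legendre (n : ℕ) : (legendre n).degree = n := by
  refine le_antisymm (degree_legendre_le n) (not_lt.1 fun h => ?_)
  have h1 := integral_legendre_mul_eq_zero h
  rw [integral_legendre_sq] at h1
  have : (0 : ℝ) < 2 / (2 * n + 1) := by positivity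
  linarith

/-- The reproducing kernel of the polynomials of degree less than `N`, with respect to the
uniform probability measure on `(-1, 1)`. -/
noncomputable def legendreKernel (N : ℕ) (x y : ℝ) : ℝ :=
  ∑ k ∈ Finset.range N, (2 * (k : ℝ) + 1) * ((legendre k).eval x * (legendre k).eval y)

theorem abs_legendreKernel_le (N : ℕ) {x y : ℝ} (hx : x ∈ Set.Icc (-1 : ℝ) 1)
    (hy : y ∈ Set.Icc (-1 : ℝ) 1) : |legendreKernel N x y| ≤ (N : ℝ) ^ 2 := by
  have hs : ∑ k ∈ Finset.range N, (2 * (k : ℝ) + 1) = (N : ℝ) ^ 2 := by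
    induction N with
    | zero => simp
    | succ n ih => rw [Finset.sum_range_succ, ih]; push_cast; ring
  rw [← hs]
  refine (Finset.abs_sum_le_sum_abs _ _).trans (Finset.sum_le_sum fun k _ => ?_)
  rw [abs_mul, abs_mul, abs_of_nonneg (by positivity : (0 : ℝ) ≤ 2 * k + 1)]
  refine mul_le_of_le_one_right (by positivity) ?_
  exact mul_le_one₀ (abs_legendre_eval_le_one k hx) (abs_nonneg _) (abs_legendre_eval_le_one k hy)

theorem continuous_legendreKernel (N : ℕ) :
    Continuous fun z : ℝ × ℝ => legendreKernel N z.1 z.2 := by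
  unfold legendreKernel
  refine continuous_finsetSum _ fun k _ => ?_
  exact continuous_const.mul (((legendre k).continuous.comp continuous_fst).mul
    ((legendre k).continuous.comp continuous_snd))

/-- The factor `2` is the length of the interval, as the kernel is normalised for the probability
measure. -/
theorem legendreKernel_reproduces {N : ℕ} {p : ℝ[X]} (hp : p.degree < N) (x : ℝ) :
    ∫ y in (-1 : ℝ)..1, legendreKernel N x y * p.eval y = 2 * p.eval x := by
  have hK : ∀ N (p : ℝ[X]), ∫ y in (-1 : ℝ)..1, legendreKernel N x y * p.eval y =
      ∑ k ∈ Finset.range N, (2 * (k : ℝ) + 1) * (legendre k).eval x *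
        ∫ y in (-1 : ℝ)..1, (legendre k * p).eval y := by
    intro N p
    simp only [← intervalIntegral.integral_const_mul]
    rw [← intervalIntegral.integral_finsetSum
      fun k _ => (intervalIntegrable_eval _ _ _).const_mul _]
    refine intervalIntegral.integral_congr fun y _ => ?_
    simp only [legendreKernel, Finset.sum_mul, eval_mul]
    exact Finset.sum_congr rfl fun k _ => by ring
  induction N generalizing p with
  | zero =>
    have : p = 0 := by simpa using hp
    simp [this]
  | succ N ih =>
    set P := legendre N
    have hP : P.coeff N ≠ 0 := by
      have h := degree_legendre N
      exact coeff_ne_zero_of_eq_degree h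
    -- This choice cancels the coefficient of `X ^ N`, so the induction hypothesis applies to `p - c
    -- P`.
    set c := p.coeff N / P.coeff N
    have hq : (p - C c * P).degree < N := by
      rw [degree_lt_iff_coeff_zero]
      intro m hm
      rcases hm.eq_or_lt with rfl | hm
      · simp [c, hP]
      · have h1 : P.coeff m = 0 := coeff_eq_zero_of_degree_lt
          ((degree_legendre_le N).trans_lt (by exact_mod_cast hm))
        have h2 : p.coeff m = 0 := coeff_eq_zero_of_degree_lt
          (hp.trans_le (by exact_mod_cast hm))
        simp [h1, h2]
    have hlin : ∀ k, ∫ y in (-1 : ℝ)..1, (legendre k * p).eval y =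
        (∫ y in (-1 : ℝ)..1, (legendre k * (p - C c * P)).eval y) +
          c * ∫ y in (-1 : ℝ)..1, (legendre k * P).eval y := by
      intro k
      rw [← intervalIntegral.integral_const_mul, ← intervalIntegral.integral_add
        (intervalIntegrable_eval _ _ _) ((intervalIntegrable_eval _ _ _).const_mul _)]
      refine intervalIntegral.integral_congr fun y _ => ?_
      simp
      ring
    have h1 := ih hq
    rw [hK] at h1 ⊢
    rw [Finset.sum_range_succ]
    have h2 : ∀ k ∈ Finset.range N, (2 * (k : ℝ) + 1) * (legendre k).eval x *
        ∫ y in (-1 : ℝ)..1, (legendre k * p).eval y =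
        (2 * (k : ℝ) + 1) * (legendre k).eval x *
        ∫ y in (-1 : ℝ)..1, (legendre k * (p - C c * P)).eval y := by
      intro k hk
      have : ∫ y in (-1 : ℝ)..1, (legendre k * P).eval y = 0 := by
        rw [mul_comm]
        refine integral_legendre_mul_eq_zero ?_
        rw [degree_legendre]
        exact_mod_cast Finset.mem_range.1 hk
      rw [hlin, this, mul_zero, add_zero]
    rw [Finset.sum_congr rfl h2, h1, hlin, integral_legendre_mul_eq_zero hq, integral_legendre_sq]
    simp only [eval_sub, eval_mul, eval_C]
    field_simp
    ring

end Legendre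

/-! ### Polynomial approximation of functions holomorphic near a Bernstein ellipse. -/

section Chebyshev

open Metric Real

/-- The Joukowski map is invariant under `z ↦ z⁻¹`, so `F ∘ J` is holomorphic on both sides of the
unit circle. -/
theorem joukowski_mem_bernsteinEllipse {ρ : ℝ} (hρ : 1 < ρ) {z : ℂ} (h1 : ρ⁻¹ ≤ ‖z‖)
    (h2 : ‖z‖ ≤ ρ) : (z + z⁻¹) / 2 ∈ bernsteinEllipse ρ := by
  have h0 : 0 < ‖z‖ := (inv_pos.2 (by linarith)).trans_le h1
  rcases le_total 1 ‖z‖ with h | h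
  · exact ⟨z, h, h2, rfl⟩
  · refine ⟨z⁻¹, ?_, ?_, by rw [inv_inv, add_comm]⟩
    · rw [norm_inv]
      exact (one_le_inv₀ h0).2 h
    · rw [norm_inv]
      exact inv_le_of_inv_le₀ (by linarith) h1

theorem ofReal_mem_bernsteinEllipse {ρ : ℝ} (hρ : 1 < ρ) {x : ℝ} (hx : x ∈ Set.Icc (-1 : ℝ) 1) :
    (x : ℂ) ∈ bernsteinEllipse ρ := by
  refine ⟨Complex.exp (arccos x * Complex.I), ?_, ?_, ?_⟩
  · rw [Complex.norm_exp_ofReal_mul_I]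
  · rw [Complex.norm_exp_ofReal_mul_I]; exact hρ.le
  · rw [← Complex.exp_neg, ← neg_mul, ← Complex.cos, ← Complex.ofReal_cos,
      cos_arccos hx.1 hx.2]

theorem isCompact_bernsteinEllipse (ρ : ℝ) : IsCompact (bernsteinEllipse ρ) := by
  have hc : IsCompact (closedBall (0 : ℂ) ρ \ ball 0 1) :=
    (isCompact_closedBall _ _).diff isOpen_ball
  have : bernsteinEllipse ρ = (fun z : ℂ => (z + z⁻¹) / 2) '' (closedBall (0 : ℂ) ρ \ ball 0 1) := by
    ext w
    simp only [bernsteinEllipse, Set.mem_ofPred_eq, Set.mem_image, Set.mem_sdiff,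
      mem_closedBall_zero_iff, mem_ball_zero_iff, not_lt]
    constructor
    · rintro ⟨z, h1, h2, rfl⟩; exact ⟨z, ⟨h2, h1⟩, rfl⟩
    · rintro ⟨z, ⟨h2, h1⟩, rfl⟩; exact ⟨z, h1, h2, rfl⟩
  rw [this]
  refine hc.image_of_continuousOn ?_
  have hne : ∀ z ∈ closedBall (0 : ℂ) ρ \ ball 0 1, z ≠ 0 := by
    rintro z ⟨-, hz⟩ rfl
    simp at hz
  exact (continuousOn_id.add (continuousOn_id.inv₀ hne)).div_const _

variable {ρ : ℝ} {O : Set ℂ} {F : ℂ → ℂ} {M : ℝ}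

/-- Laurent coefficients of `F ∘ J`, `J` the Joukowski map, decay geometrically. -/
theorem norm_circleIntegral_joukowski_le (hρ : 1 < ρ) (hO : IsOpen O)
    (hE : bernsteinEllipse ρ ⊆ O) (hF : DifferentiableOn ℂ F O)
    (hM : ∀ w ∈ bernsteinEllipse ρ, ‖F w‖ ≤ M) (k : ℤ) :
    ‖∮ z in C(0, 1), z ^ (-k - 1) * F ((z + z⁻¹) / 2)‖ ≤ 2 * π * (M * ρ⁻¹ ^ k.natAbs) := by
  have hρ0 : 0 < ρ := by linarith
  have hρi : ρ⁻¹ ≤ 1 := inv_le_one_of_one_le₀ hρ.le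
  set g : ℂ → ℂ := fun z => z ^ (-k - 1) * F ((z + z⁻¹) / 2) with hg
  have hdiff : ∀ z : ℂ, ρ⁻¹ ≤ ‖z‖ → ‖z‖ ≤ ρ → DifferentiableAt ℂ g z := by
    intro z h1 h2
    have hz : z ≠ 0 := norm_pos_iff.1 ((inv_pos.2 hρ0).trans_le h1)
    have hFd : DifferentiableAt ℂ F ((z + z⁻¹) / 2) :=
      hF.differentiableAt (hO.mem_nhds (hE (joukowski_mem_bernsteinEllipse hρ h1 h2)))
    have hJ : DifferentiableAt ℂ (fun z : ℂ => (z + z⁻¹) / 2) z :=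
      (differentiableAt_id.add (differentiableAt_inv hz)).div_const _
    exact (differentiableAt_zpow.2 (Or.inl hz)).mul (hFd.comp z hJ)
  have hann : ∀ r R : ℝ, ρ⁻¹ ≤ r → r ≤ R → R ≤ ρ → (∮ z in C(0, R), g z) = ∮ z in C(0, r), g z := by
    intro r R h1 h2 h3
    refine Complex.circleIntegral_eq_of_differentiable_on_annulus_off_countable
      ((inv_pos.2 hρ0).trans_le h1) h2 Set.countable_empty ?_ ?_
    · rintro z ⟨hz1, hz2⟩
      simp only [mem_closedBall_zero_iff, mem_ball_zero_iff, not_lt] at hz1 hz2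
      exact (hdiff z (h1.trans hz2) (hz1.trans h3)).continuousAt.continuousWithinAt
    · rintro z ⟨⟨hz1, hz2⟩, -⟩
      simp only [mem_closedBall_zero_iff, mem_ball_zero_iff, not_le] at hz1 hz2
      exact hdiff z (h1.trans hz2.le) (hz1.le.trans h3)
  have hbound : ∀ R : ℝ, ρ⁻¹ ≤ R → R ≤ ρ →
      ‖∮ z in C(0, R), g z‖ ≤ 2 * π * (M * R ^ (-k)) := by
    intro R h1 h2
    have hR : 0 < R := (inv_pos.2 hρ0).trans_le h1
    have := circleIntegral.norm_integral_le_of_norm_le_const (f := g) (c := 0)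
      (C := R ^ (-k - 1) * M) hR.le (by
        intro z hz
        have hz : ‖z‖ = R := by simpa using hz
        rw [hg]
        simp only [norm_mul, norm_zpow, hz]
        gcongr
        exact hM _ (joukowski_mem_bernsteinEllipse hρ (hz ▸ h1) (hz ▸ h2)))
    refine this.trans_eq ?_
    rw [zpow_sub_one₀ hR.ne']
    field_simp
  -- The contour is moved out to radius `ρ` for `k ≥ 0` and in to `ρ⁻¹` for `k ≤ 0`.
  rcases le_total 0 k with hk | hk
  · rw [← hann 1 ρ hρi hρ.le le_rfl]
    refine (hbound ρ (hρi.trans hρ.le) le_rfl).trans_eq ?_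
    lift k to ℕ using hk
    simp
  · rw [hann ρ⁻¹ 1 le_rfl hρi hρ.le]
    refine (hbound ρ⁻¹ le_rfl (hρi.trans hρ.le)).trans_eq ?_
    obtain ⟨n, rfl⟩ := Int.exists_eq_neg_ofNat hk
    simp

/-- A function holomorphic near a Bernstein ellipse is approximated on `[-1, 1]` by polynomials
at a geometric rate. -/
theorem exists_polynomial_approx (hρ : 1 < ρ) (hO : IsOpen O)
    (hE : bernsteinEllipse ρ ⊆ O) (hF : DifferentiableOn ℂ F O)
    (hM : ∀ w ∈ bernsteinEllipse ρ, ‖F w‖ ≤ M) (N : ℕ) :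
    ∃ p : ℝ[X], p.degree < N ∧ ∀ x ∈ Set.Icc (-1 : ℝ) 1,
      |p.eval x - (F x).re| ≤ 2 * M * ρ⁻¹ ^ N / (1 - ρ⁻¹) := by
  have hρ0 : 0 < ρ := by linarith
  have hρi : ρ⁻¹ < 1 := inv_lt_one_of_one_lt₀ hρ
  have hM0 : 0 ≤ M := (norm_nonneg _).trans
    (hM _ (ofReal_mem_bernsteinEllipse hρ (x := 0) (by norm_num)))
  have : Fact (0 < 2 * π) := ⟨two_pi_pos⟩
  -- This is `θ ↦ F (cos θ)`; its Fourier coefficients are the Laurent coefficients of `F ∘ J`.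
  let G : C(AddCircle (2 * π), ℂ) :=
    ⟨fun t => F (((AddCircle.toCircle t : ℂ) + (AddCircle.toCircle t : ℂ)⁻¹) / 2), by
      refine hF.continuousOn.comp_continuous ?_ ?_
      · have h : Continuous fun t : AddCircle (2 * π) => (AddCircle.toCircle t : ℂ) :=
          continuous_subtype_val.comp AddCircle.continuous_toCircle
        exact (h.add (h.inv₀ fun t => Circle.coe_ne_zero _)).div_const _
      · intro t
        exact hE (joukowski_mem_bernsteinEllipse hρ (by rw [Circle.norm_coe]; exact hρi.le)
          (by rw [Circle.norm_coe]; exact hρ.le))⟩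
  have hcoe : ∀ θ : ℝ, ((AddCircle.toCircle (θ : AddCircle (2 * π)) : Circle) : ℂ) =
      Complex.exp (θ * Complex.I) := by
    intro θ
    rw [AddCircle.toCircle_apply_mk, Circle.coe_exp, div_self two_pi_pos.ne', one_mul]
  set a : ℤ → ℂ := fourierCoeff G with ha
  have hab : ∀ k, ‖a k‖ ≤ M * ρ⁻¹ ^ k.natAbs := by
    intro k
    have h1 : a k = (2 * π * Complex.I)⁻¹ *
        ∮ z in C(0, 1), z ^ (-k - 1) * F ((z + z⁻¹) / 2) := by
      rw [ha, fourierCoeff_eq_intervalIntegral _ _ 0, circleIntegral, zero_add, mul_inv,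
        mul_assoc, ← intervalIntegral.integral_const_mul, Complex.real_smul]
      congr 1
      · push_cast; rw [one_div]
      · refine intervalIntegral.integral_congr fun θ _ => ?_
        simp only [G, ContinuousMap.coe_mk, hcoe, fourier_coe_apply, smul_eq_mul, deriv_circleMap,
          circleMap_zero, Complex.ofReal_one, one_mul]
        rw [zpow_sub_one₀ (Complex.exp_ne_zero _), ← Complex.exp_int_mul]
        have : (2 * (π : ℂ) * Complex.I * ((-k : ℤ) : ℂ) * θ / ((2 * π : ℝ) : ℂ)) =
            ((-k : ℤ) : ℂ) * (θ * Complex.I) := by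
          have : (π : ℂ) ≠ 0 := by exact_mod_cast pi_ne_zero
          push_cast
          field_simp
        rw [this]
        have h2 := Complex.exp_ne_zero (θ * Complex.I)
        field_simp
    rw [h1, norm_mul]
    have h2 := norm_circleIntegral_joukowski_le hρ hO hE hF hM k
    have h3 : ‖(2 * (π : ℂ) * Complex.I)⁻¹‖ = (2 * π)⁻¹ := by
      simp [abs_of_pos pi_pos]
    rw [h3]
    calc (2 * π)⁻¹ * _ ≤ (2 * π)⁻¹ * (2 * π * (M * ρ⁻¹ ^ k.natAbs)) := by gcongr
      _ = _ := by field_simp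
  have hsum1 : Summable fun k : ℤ => M * ρ⁻¹ ^ k.natAbs := by
    refine Summable.mul_left _ ?_
    have := summable_geometric_of_lt_one (inv_pos.2 hρ0).le hρi
    exact Summable.of_nat_of_neg (by simpa using this) (by simpa using this)
  have hsum : Summable a := Summable.of_norm_bounded hsum1 hab
  -- Chebyshev coefficients of `F`; the subtraction corrects the double count of `a 0`.
  let A : ℕ → ℂ := fun n => a n + a (-n) - if n = 0 then a 0 else 0
  have hA : ∀ n, ‖A n‖ ≤ 2 * M * ρ⁻¹ ^ n := by
    intro n
    rcases Nat.eq_zero_or_pos n with rfl | hn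
    · have := hab 0
      simp only [Int.natAbs_zero, pow_zero, mul_one] at this
      simp [A]
      linarith
    · simp only [A, hn.ne', if_false, sub_zero]
      have h1 := hab n
      have h2 := hab (-n)
      simp only [Int.natAbs_neg, Int.natAbs_natCast] at h1 h2
      linarith [norm_add_le (a n) (a (-n))]
  refine ⟨∑ n ∈ Finset.range N, C (A n).re * Chebyshev.T ℝ n, ?_, ?_⟩
  · rw [← mem_degreeLT]
    refine Submodule.sum_mem _ fun n hn => ?_
    rw [mem_degreeLT]
    rw [← smul_eq_C_mul]
    refine (degree_smul_le _ _).trans_lt ?_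
    rw [Chebyshev.degree_T]
    simpa using hn
  · intro x hx
    have hFx : HasSum (fun n => A n * (cos (n * arccos x) : ℝ)) (F x) := by
      have hs := has_pointwise_sum_fourier_series_of_summable (f := G) hsum
      have hG : ∀ θ : ℝ, G (θ : AddCircle (2 * π)) = F (cos θ) := by
        intro θ
        simp only [G, ContinuousMap.coe_mk, hcoe]
        rw [← Complex.exp_neg, ← neg_mul, ← Complex.cos, ← Complex.ofReal_cos]
      have hf : ∀ (k : ℤ) (θ : ℝ), fourier k (θ : AddCircle (2 * π)) =
          Complex.exp (k * θ * Complex.I) := by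
        intro k θ
        rw [fourier_coe_apply]
        congr 1
        have : (π : ℂ) ≠ 0 := by exact_mod_cast pi_ne_zero
        push_cast
        field_simp
      have h1 := hs ((arccos x : ℝ) : AddCircle (2 * π))
      have h2 := hs ((-arccos x : ℝ) : AddCircle (2 * π))
      rw [hG] at h1 h2
      rw [cos_neg] at h2
      rw [cos_arccos hx.1 hx.2] at h1 h2
      -- Averaging the series at `θ` and `-θ` leaves only cosines, with no need for `a (-n) = a n`.
      have h3 := (h1.add h2).mul_right (1 / 2)
      have h4 := h3.nat_add_neg.sub (hasSum_ite_eq 0 (a 0))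
      convert h4 using 1
      · rfl
      · funext n
        simp only [hf, smul_eq_mul, ← ha, A]
        push_cast
        rw [Complex.cos]
        have e1 : (-(n : ℂ)) * -(arccos x : ℂ) * Complex.I = n * arccos x * Complex.I := by ring
        have e2 : (-(n : ℂ)) * (arccos x : ℂ) * Complex.I = -(n * arccos x) * Complex.I := by ring
        have e3 : (n : ℂ) * -(arccos x : ℂ) * Complex.I = -(n * arccos x) * Complex.I := by ring
        rw [e1, e2, e3]
        rcases Nat.eq_zero_or_pos n with rfl | hn
        · simp; ring
        · simp [hn.ne']; ring
      · simp only [hf, smul_eq_mul, ← ha]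
        simp
        ring
    have hre := Complex.hasSum_re hFx
    have := norm_sub_le_of_geometric_bound_of_hasSum hρi (C := 2 * M) (fun n => ?_) hre N
    · rw [Real.norm_eq_abs] at this
      convert this using 3
      rw [eval_finsetSum]
      refine Finset.sum_congr rfl fun n _ => ?_
      rw [eval_mul, eval_C, Complex.re_mul_ofReal]
      congr 1
      conv_lhs => rw [← cos_arccos hx.1 hx.2]
      rw [Chebyshev.T_real_cos]
      simp
    · rw [Complex.re_mul_ofReal, norm_mul]
      refine le_trans ?_ (hA n)
      refine (mul_le_of_le_one_right (norm_nonneg _) (abs_cos_le_one _)).trans ?_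
      exact Complex.abs_re_le_norm _

end Chebyshev

/-! ### Tensor products of one-variable projections. -/

section Tensor

/-- The uniform probability measure on the interval `(-1, 1)`. -/
noncomputable def uniformIoo : Measure ℝ := ProbabilityTheory.cond volume (Set.Ioo (-1 : ℝ) 1)

instance : IsProbabilityMeasure uniformIoo :=
  ProbabilityTheory.cond_isProbabilityMeasure_of_finite (by simp) (by simp)

theorem ae_mem_uniformIoo : ∀ᵐ t ∂uniformIoo, t ∈ Set.Ioo (-1 : ℝ) 1 :=
  ProbabilityTheory.ae_cond_mem measurableSet_Ioo

theorem integral_uniformIoo (G : ℝ → ℝ) :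
    ∫ t, G t ∂uniformIoo = 1 / 2 * ∫ t in (-1 : ℝ)..1, G t := by
  rw [uniformIoo, ProbabilityTheory.cond, integral_smul_measure,
    intervalIntegral.integral_of_le (by norm_num), integral_Ioc_eq_integral_Ioo]
  simp
  norm_num

theorem cube_eq_pi (d : ℕ) : cube d = Set.univ.pi fun _ => Set.Ioo (-1 : ℝ) 1 := by
  ext x; simp [cube]

theorem measurableSet_cube (d : ℕ) : MeasurableSet (cube d) := by
  rw [cube_eq_pi]
  exact MeasurableSet.univ_pi fun _ => measurableSet_Ioo

theorem uniformMeasure_eq_pi (d : ℕ) :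
    uniformMeasure d = Measure.pi fun _ : Fin d => uniformIoo := by
  symm
  refine Measure.pi_eq fun s hs => ?_
  rw [uniformMeasure, ProbabilityTheory.cond_apply (measurableSet_cube d), cube_eq_pi,
    ← Set.pi_inter_distrib, volume_pi_pi, volume_pi_pi]
  simp only [uniformIoo, ProbabilityTheory.cond_apply measurableSet_Ioo]
  rw [Finset.prod_mul_distrib, Finset.prod_const, Finset.prod_const, ENNReal.inv_pow]

instance (d : ℕ) : IsProbabilityMeasure (uniformMeasure d) := by
  rw [uniformMeasure_eq_pi]; infer_instance

theorem ae_mem_cube (d : ℕ) : ∀ᵐ x ∂uniformMeasure d, x ∈ cube d :=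
  ProbabilityTheory.ae_cond_mem (measurableSet_cube d)

theorem integrable_of_le_on_cube {d : ℕ} {h : (Fin d → ℝ) → ℝ} (hm : Measurable h) {B : ℝ}
    (hB : ∀ x ∈ cube d, |h x| ≤ B) : Integrable h (uniformMeasure d) :=
  Integrable.of_bound hm.aestronglyMeasurable B ((ae_mem_cube d).mono hB)

/-- Resampling one coordinate preserves a product of probability measures. -/
theorem measurePreserving_update {ι : Type*} [Fintype ι] [DecidableEq ι] {X : ι → Type*}
    [∀ i, MeasurableSpace (X i)] (μ : ∀ i, Measure (X i)) [∀ i, IsProbabilityMeasure (μ i)]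
    (j : ι) :
    MeasurePreserving (fun z : (∀ i, X i) × X j => Function.update z.1 j z.2)
      ((Measure.pi μ).prod (μ j)) (Measure.pi μ) := by
  have hm : Measurable fun z : (∀ i, X i) × X j => Function.update z.1 j z.2 := by
    refine measurable_pi_iff.2 fun i => ?_
    by_cases h : i = j
    · subst h; simpa using measurable_snd
    · simpa [h, Function.comp_def] using (measurable_pi_apply i).comp measurable_fst
  refine ⟨hm, ?_⟩
  symm
  refine Measure.pi_eq fun s hs => ?_
  rw [Measure.map_apply hm (MeasurableSet.univ_pi hs)]
  have : (fun z : (∀ i, X i) × X j => Function.update z.1 j z.2) ⁻¹' (Set.univ.pi s) =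
      (Set.univ.pi (Function.update s j Set.univ)) ×ˢ s j := by
    ext ⟨y, t⟩
    simp only [Set.mem_preimage, Set.mem_pi, Set.mem_univ, true_imp_iff, Set.mem_prod]
    constructor
    · intro h
      refine ⟨fun i => ?_, by simpa using h j⟩
      by_cases hi : i = j
      · subst hi; simp
      · simpa [hi] using h i
    · rintro ⟨h1, h2⟩ i
      by_cases hi : i = j
      · subst hi; simpa using h2
      · simpa [hi] using h1 i
  rw [this, Measure.prod_prod, Measure.pi_pi,
    ← Finset.mul_prod_erase Finset.univ (fun i => μ i (s i)) (Finset.mem_univ j),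
    ← Finset.mul_prod_erase Finset.univ _ (Finset.mem_univ j), mul_comm]
  congr 1
  simp only [Function.update_self, measure_univ, one_mul]
  refine Finset.prod_congr rfl fun i hi => ?_
  rw [Function.update_of_ne (Finset.ne_of_mem_erase hi)]

theorem update_mem_cube {d : ℕ} {z : Fin d → ℝ} (hz : z ∈ cube d) (j : Fin d) {t : ℝ}
    (ht : t ∈ Set.Ioo (-1 : ℝ) 1) : Function.update z j t ∈ cube d := by
  intro i
  by_cases h : i = j
  · subst h; simpa using ht
  · simpa [h] using hz i

theorem piecewise_mem_cube {d : ℕ} {y x : Fin d → ℝ} (hy : y ∈ cube d) (hx : x ∈ cube d)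
    (A : Finset (Fin d)) : A.piecewise y x ∈ cube d := by
  intro i
  by_cases h : i ∈ A
  · simpa [h] using hy i
  · simpa [h] using hx i

/-- Tensor products of kernel operators: errors of the factors add up. -/
theorem abs_integral_prod_kernel_sub_le {d : ℕ} {g : (Fin d → ℝ) → ℝ} (hg : Measurable g) {B : ℝ}
    (hB : ∀ x, |g x| ≤ B) {K : Fin d → ℝ → ℝ → ℝ}
    (hK : ∀ i, Continuous fun z : ℝ × ℝ => K i z.1 z.2) {κ e : Fin d → ℝ} (hκ1 : ∀ i, 1 ≤ κ i)
    (hκ : ∀ i, ∀ s ∈ Set.Ioo (-1 : ℝ) 1, ∀ t ∈ Set.Ioo (-1 : ℝ) 1, |K i s t| ≤ κ i)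
    (he : ∀ j, ∀ z ∈ cube d,
      |∫ t, K j (z j) t * g (Function.update z j t) ∂uniformIoo - g z| ≤ e j)
    {x : Fin d → ℝ} (hx : x ∈ cube d) :
    |∫ y, (∏ i, K i (x i) (y i)) * g y ∂(uniformMeasure d) - g x| ≤ (∏ i, κ i) * ∑ j, e j := by
  classical
  have hκ0 : ∀ i, 0 ≤ κ i := fun i => zero_le_one.trans (hκ1 i)
  -- The operators act in the coordinates in `A`, the others being frozen at `x`. Growing `A` from
  -- `∅` to `univ` telescopes from `g x` to the full integral.
  let H : Finset (Fin d) → (Fin d → ℝ) → ℝ := fun A y =>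
    (∏ i ∈ A, K i (x i) (y i)) * g (A.piecewise y x)
  have hprod : ∀ (A : Finset (Fin d)), ∀ y ∈ cube d, |∏ i ∈ A, K i (x i) (y i)| ≤ ∏ i, κ i := by
    intro A y hy
    rw [Finset.abs_prod]
    calc ∏ i ∈ A, |K i (x i) (y i)| ≤ ∏ i ∈ A, κ i :=
          Finset.prod_le_prod (fun _ _ => abs_nonneg _) fun i _ => hκ i _ (hx i) _ (hy i)
      -- Here `1 ≤ κ i` is essential: it pads the partial product to a bound independent of `A`.
      _ ≤ ∏ i, κ i := Finset.prod_le_prod_of_subset_of_one_le (Finset.subset_univ A)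
          (fun i _ => hκ0 i)
          fun i _ _ => hκ1 i
  have hprod_meas : ∀ A : Finset (Fin d), Measurable fun y : Fin d → ℝ =>
      ∏ i ∈ A, K i (x i) (y i) := fun A =>
    Finset.measurable_prod _ fun i _ =>
      (((hK i).comp (Continuous.prodMk_right (x i))).measurable).comp (measurable_pi_apply i)
  have hHm : ∀ A, Measurable (H A) := by
    intro A
    refine (hprod_meas A).mul (hg.comp (measurable_pi_iff.2 fun i => ?_))
    by_cases h : i ∈ A
    · simpa [h] using measurable_pi_apply i
    · simp [h]
  have hHi : ∀ A, Integrable (H A) (uniformMeasure d) := fun A =>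
    integrable_of_le_on_cube (hHm A) (B := (∏ i, κ i) * B) fun y hy => by
      simp only [H, abs_mul]
      exact mul_le_mul (hprod A y hy) (hB _) (abs_nonneg _)
        (Finset.prod_nonneg fun i _ => hκ0 i)
  have key : ∀ A : Finset (Fin d),
      |∫ y, H A y ∂(uniformMeasure d) - g x| ≤ (∏ i, κ i) * ∑ j ∈ A, e j := by
    intro A
    induction A using Finset.induction_on with
    | empty => simp [H]
    | insert j A hj ih =>
      have hmp := measurePreserving_update (fun _ : Fin d => uniformIoo) j
      rw [← uniformMeasure_eq_pi] at hmp
      have hint : Integrable (fun z : (Fin d → ℝ) × ℝ => H (insert j A) (Function.update z.1 j z.2))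
          ((uniformMeasure d).prod uniformIoo) :=
        (hmp.integrable_comp (hHm _).aestronglyMeasurable).2 (hHi _)
      have h1 : ∫ y, H (insert j A) y ∂(uniformMeasure d) =
          ∫ y, ∫ t, H (insert j A) (Function.update y j t) ∂uniformIoo ∂(uniformMeasure d) := by
        rw [← integral_prod _ hint, ← integral_map hmp.measurable.aemeasurable
          (by rw [hmp.map_eq]; exact (hHm _).aestronglyMeasurable), hmp.map_eq]
      -- Resampling coordinate `j` isolates the one-variable error of `K j` at the mixed point,
      -- whose `j`-th coordinate is still `x j`.
      have h2 : ∀ y, (∫ t, H (insert j A) (Function.update y j t) ∂uniformIoo) - H A y =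
          (∏ i ∈ A, K i (x i) (y i)) *
            (∫ t, K j ((A.piecewise y x) j) t * g (Function.update (A.piecewise y x) j t)
              ∂uniformIoo - g (A.piecewise y x)) := by
        intro y
        rw [mul_sub, ← integral_const_mul]
        congr 1
        refine integral_congr_ae (Filter.Eventually.of_forall fun t => ?_)
        have e1 : (insert j A).piecewise (Function.update y j t) x =
            Function.update (A.piecewise y x) j t := by
          funext i
          by_cases hi : i = j
          · subst hi; simp
          · by_cases hA : i ∈ A <;> simp [hi, hA]
        have e2 : ∏ i ∈ A, K i (x i) (Function.update y j t i) = ∏ i ∈ A, K i (x i) (y i) :=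
          Finset.prod_congr rfl fun i hi => by
            rw [Function.update_of_ne (ne_of_mem_of_not_mem hi hj)]
        simp only [H, Finset.prod_insert hj, e1, e2, Function.update_self,
          Finset.piecewise_eq_of_notMem _ _ _ hj]
        ring
      have h3 : |∫ y, H (insert j A) y ∂(uniformMeasure d) - ∫ y, H A y ∂(uniformMeasure d)| ≤
          (∏ i, κ i) * e j := by
        rw [h1, ← integral_sub hint.integral_prod_left (hHi A)]
        have := norm_integral_le_of_norm_le_const (μ := uniformMeasure d)
          (f := fun y => (∫ t, H (insert j A) (Function.update y j t) ∂uniformIoo) - H A y)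
          (C := (∏ i, κ i) * e j) ((ae_mem_cube d).mono fun y hy => by
            rw [h2, norm_mul]
            exact mul_le_mul (hprod A y hy) (he j _ (piecewise_mem_cube hy hx A)) (abs_nonneg _)
              (Finset.prod_nonneg fun i _ => hκ0 i))
        simpa using this
      rw [Finset.sum_insert hj, mul_add]
      calc _ = |(∫ y, H (insert j A) y ∂(uniformMeasure d) - ∫ y, H A y ∂(uniformMeasure d)) +
            (∫ y, H A y ∂(uniformMeasure d) - g x)| := by ring_nf
        _ ≤ _ := (abs_add_le _ _).trans (add_le_add h3 ih)
  simpa [H] using key Finset.univ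

theorem continuous_tensorLegendre {d : ℕ} (ν : Fin d → ℕ) :
    Continuous fun x => tensorLegendre ν x := by
  unfold tensorLegendre
  exact continuous_finsetProd _ fun j _ =>
    continuous_const.mul ((legendre (ν j)).continuous.comp (continuous_apply j))

theorem abs_tensorLegendre_le {d : ℕ} (ν : Fin d → ℕ) {x : Fin d → ℝ} (hx : x ∈ cube d) :
    |tensorLegendre ν x| ≤ ∏ j, √(2 * (ν j : ℝ) + 1) := by
  rw [tensorLegendre, Finset.abs_prod]
  refine Finset.prod_le_prod (fun _ _ => abs_nonneg _) fun j _ => ?_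
  rw [abs_mul, abs_of_nonneg (Real.sqrt_nonneg _)]
  exact mul_le_of_le_one_right (Real.sqrt_nonneg _)
    (abs_legendre_eval_le_one _ (Set.Ioo_subset_Icc_self (hx j)))

/-- Expanding a product of sums produces a sum over a box; this factorisation is what boxes are
chosen for. -/
theorem prod_legendreKernel {d : ℕ} (N : Fin d → ℕ) (x y : Fin d → ℝ) :
    ∏ j, legendreKernel (N j) (x j) (y j) =
      ∑ ν ∈ Fintype.piFinset fun j => Finset.range (N j),
        tensorLegendre ν x * tensorLegendre ν y := by
  simp only [legendreKernel, Finset.prod_univ_sum, tensorLegendre, ← Finset.prod_mul_distrib]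
  refine Finset.sum_congr rfl fun ν _ => Finset.prod_congr rfl fun j _ => ?_
  have h := Real.mul_self_sqrt (by positivity : (0 : ℝ) ≤ 2 * (ν j : ℝ) + 1)
  linear_combination (-((legendre (ν j)).eval (x j) * (legendre (ν j)).eval (y j))) * h

theorem truncatedExpansion_piFinset {d : ℕ} {g : (Fin d → ℝ) → ℝ} (hg : Measurable g) {B : ℝ}
    (hB : ∀ x, |g x| ≤ B) (N : Fin d → ℕ) (x : Fin d → ℝ) :
    truncatedExpansion g (Fintype.piFinset fun j => Finset.range (N j)) x =
      ∫ y, (∏ j, legendreKernel (N j) (x j) (y j)) * g y ∂(uniformMeasure d) := by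
  simp only [prod_legendreKernel, truncatedExpansion, legendreCoeff, Finset.sum_mul]
  rw [integral_finsetSum]
  · refine Finset.sum_congr rfl fun ν _ => ?_
    rw [← integral_mul_const]
    exact integral_congr_ae (Filter.Eventually.of_forall fun y => by ring)
  · intro ν _
    have : Integrable (fun y => tensorLegendre ν y * g y) (uniformMeasure d) :=
      integrable_of_le_on_cube ((continuous_tensorLegendre ν).measurable.mul hg)
        (B := (∏ j, √(2 * (ν j : ℝ) + 1)) * B) fun y hy => by
          rw [abs_mul]
          exact mul_le_mul (abs_tensorLegendre_le ν hy) (hB y) (abs_nonneg _)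
            (Finset.prod_nonneg fun j _ => Real.sqrt_nonneg _)
    simpa only [mul_assoc] using this.const_mul (tensorLegendre ν x)

/-- The Legendre projection of degree less than `N` is quasi-optimal, up to the factor
`(1 + N) ^ 2`. -/
theorem abs_integral_legendreKernel_sub_le {h : ℝ → ℝ} (hm : Measurable h) {N : ℕ} {p : ℝ[X]}
    (hp : p.degree < N) {ε : ℝ} (hε : ∀ t ∈ Set.Ioo (-1 : ℝ) 1, |h t - p.eval t| ≤ ε) {s : ℝ}
    (hs : s ∈ Set.Ioo (-1 : ℝ) 1) :
    |∫ t, legendreKernel N s t * h t ∂uniformIoo - h s| ≤ (1 + (N : ℝ)) ^ 2 * ε := by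
  have hs' := Set.Ioo_subset_Icc_self hs
  have hKm : Measurable fun t => legendreKernel N s t :=
    ((continuous_legendreKernel N).comp (Continuous.prodMk_right s)).measurable
  have hε0 : 0 ≤ ε := (abs_nonneg _).trans (hε s hs)
  have hbd : ∀ᵐ t ∂uniformIoo, ‖legendreKernel N s t * (h t - p.eval t)‖ ≤ (N : ℝ) ^ 2 * ε :=
    ae_mem_uniformIoo.mono fun t ht => by
      rw [norm_mul]
      exact mul_le_mul (abs_legendreKernel_le N hs' (Set.Ioo_subset_Icc_self ht)) (hε t ht)
        (abs_nonneg _) (by positivity)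
  have hi1 : Integrable (fun t => legendreKernel N s t * (h t - p.eval t)) uniformIoo :=
    Integrable.of_bound (hKm.mul (hm.sub p.continuous.measurable)).aestronglyMeasurable _ hbd
  have hi2 : Integrable (fun t => legendreKernel N s t * p.eval t) uniformIoo := by
    obtain ⟨b, hb⟩ := (isCompact_Icc (a := (-1 : ℝ)) (b := 1)).exists_bound_of_continuousOn
      p.continuous.continuousOn
    refine Integrable.of_bound (hKm.mul p.continuous.measurable).aestronglyMeasurable
      ((N : ℝ) ^ 2 * b) (ae_mem_uniformIoo.mono fun t ht => ?_)
    have ht' := Set.Ioo_subset_Icc_self ht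
    rw [norm_mul]
    exact mul_le_mul (abs_legendreKernel_le N hs' ht') (hb t ht') (norm_nonneg _) (by positivity)
  -- Since the kernel reproduces `p`, only `h - p` contributes: `N² ε` from the integral and `ε`
  -- from the value at `s`.
  have h1 : ∫ t, legendreKernel N s t * h t ∂uniformIoo =
      ∫ t, legendreKernel N s t * (h t - p.eval t) ∂uniformIoo + p.eval s := by
    have h2 : ∫ t, legendreKernel N s t * p.eval t ∂uniformIoo = p.eval s := by
      rw [integral_uniformIoo, legendreKernel_reproduces hp]
      ring
    rw [← h2, ← integral_add hi1 hi2]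
    exact integral_congr_ae (Filter.Eventually.of_forall fun t => by ring)
  have h3 := norm_integral_le_of_norm_le_const hbd
  rw [probReal_univ, mul_one, Real.norm_eq_abs] at h3
  have h4 := hε s hs
  calc _ = |(∫ t, legendreKernel N s t * (h t - p.eval t) ∂uniformIoo) + -(h s - p.eval s)| := by
        rw [h1]; ring_nf
    _ ≤ N ^ 2 * ε + ε := (abs_add_le _ _).trans (by rw [abs_neg]; exact add_le_add h3 h4)
    _ ≤ _ := by nlinarith [mul_nonneg (Nat.cast_nonneg (α := ℝ) N) hε0]

end Tensor

/-! ### Error on a box, and comparison of rates. -/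

section Main

theorem ofReal_mem_bernsteinPolyellipse {d : ℕ} {ρ : Fin d → ℝ} (hρ : ∀ j, 1 < ρ j)
    {x : Fin d → ℝ} (hx : x ∈ cube d) : (fun j => (x j : ℂ)) ∈ bernsteinPolyellipse ρ :=
  fun j _ => ofReal_mem_bernsteinEllipse (hρ j) (Set.Ioo_subset_Icc_self (hx j))

theorem truncatedExpansion_congr {d : ℕ} {f g : (Fin d → ℝ) → ℝ} (h : Set.EqOn f g (cube d))
    (Λ : Finset (Fin d → ℕ)) : truncatedExpansion f Λ = truncatedExpansion g Λ := by
  funext x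
  refine Finset.sum_congr rfl fun ν _ => ?_
  congr 1
  exact integral_congr_ae ((ae_mem_cube d).mono fun y hy => by
    show f y * _ = g y * _
    rw [h hy])

/-- Error of the Legendre expansion truncated to a box of indices. -/
theorem exists_error_bound_piFinset {d : ℕ} {ρ : Fin d → ℝ} (hρ : ∀ j, 1 < ρ j)
    {f : (Fin d → ℝ) → ℝ} (hf : HasHolomorphicExtension ρ f) :
    ∃ c : Fin d → ℝ, (∀ j, 0 ≤ c j) ∧ ∀ (N : Fin d → ℕ), ∀ x ∈ cube d,
      |f x - truncatedExpansion f (Fintype.piFinset fun j => Finset.range (N j)) x| ≤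
        (∏ j, (1 + (N j : ℝ)) ^ 2) * ∑ j, (1 + (N j : ℝ)) ^ 2 * (c j * (ρ j)⁻¹ ^ N j) := by
  classical
  obtain ⟨O, F, hO, hE, hF, hFf⟩ := hf
  obtain ⟨M, hM⟩ := (isCompact_univ_pi fun j => isCompact_bernsteinEllipse
    (ρ j)).exists_bound_of_continuousOn (hF.continuousOn.mono hE)
  have hM0 : 0 ≤ M := (norm_nonneg _).trans
    (hM _ (ofReal_mem_bernsteinPolyellipse hρ (x := 0) fun j => by simp))
  have hcoe : Continuous fun x : Fin d → ℝ => fun j => (x j : ℂ) :=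
    continuous_pi fun j => Complex.continuous_ofReal.comp (continuous_apply j)
  -- Nothing is known about `f` off the cube; `g` agrees with it there and is measurable and bounded
  -- everywhere.
  set g : (Fin d → ℝ) → ℝ := (cube d).indicator fun x => (F fun j => (x j : ℂ)).re with hg
  have hfg : Set.EqOn f g (cube d) := fun x hx => by
    rw [hg, Set.indicator_of_mem hx, hFf x hx, Complex.ofReal_re]
  have hgm : Measurable g := by
    rw [hg, ← Set.piecewise_eq_indicator]
    refine ContinuousOn.measurable_piecewise ?_ continuousOn_const (measurableSet_cube d)
    exact Complex.continuous_re.comp_continuousOn (hF.continuousOn.comp hcoe.continuousOn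
      fun x hx => hE (ofReal_mem_bernsteinPolyellipse hρ hx))
  have hgB : ∀ x, |g x| ≤ M := by
    intro x
    by_cases hx : x ∈ cube d
    · rw [hg, Set.indicator_of_mem hx]
      exact (Complex.abs_re_le_norm _).trans (hM _ (ofReal_mem_bernsteinPolyellipse hρ hx))
    · rw [hg, Set.indicator_of_notMem hx]
      simpa using hM0
  refine ⟨fun j => 2 * M / (1 - (ρ j)⁻¹), fun j => ?_, fun N x hx => ?_⟩
  · have := inv_lt_one_of_one_lt₀ (hρ j)
    exact div_nonneg (by positivity) (by linarith)
  rw [truncatedExpansion_congr hfg, hfg hx, truncatedExpansion_piFinset hgm hgB, abs_sub_comm]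
  refine abs_integral_prod_kernel_sub_le (K := fun i => legendreKernel (N i)) hgm hgB
    (fun i => continuous_legendreKernel (N i)) (κ := fun i => (1 + (N i : ℝ)) ^ 2)
    (fun i => one_le_pow₀ (by simp)) (fun i s hs t ht => ?_) (fun j z hz => ?_) hx
  · refine (abs_legendreKernel_le _ (Set.Ioo_subset_Icc_self hs)
      (Set.Ioo_subset_Icc_self ht)).trans ?_
    gcongr
    simp
  -- A one-variable slice with the other coordinates real. It stays in the polyellipse, so the bound
  -- `M` is uniform in `z`.
  · set ζ : ℂ → Fin d → ℂ := fun w => Function.update (fun i => (z i : ℂ)) j w with hζ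
    have hζd : Differentiable ℂ ζ := by
      refine differentiable_pi.2 fun i => ?_
      by_cases h : i = j
      · subst h; simp [hζ]
      · simp [hζ, h]
    have hζm : ∀ w ∈ bernsteinEllipse (ρ j), ζ w ∈ bernsteinPolyellipse ρ := by
      intro w hw i _
      by_cases h : i = j
      · subst h; simpa [hζ] using hw
      · simpa [hζ, h] using ofReal_mem_bernsteinPolyellipse hρ hz i (Set.mem_univ i)
    obtain ⟨p, hp, hpa⟩ := exists_polynomial_approx (O := ζ ⁻¹' O) (F := F ∘ ζ) (M := M) (hρ j)
      (hO.preimage hζd.continuous) (fun w hw => hE (hζm w hw))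
      (hF.comp hζd.differentiableOn fun w hw => hw) (fun w hw => hM _ (hζm w hw)) (N j)
    have hzt : ∀ t : ℝ, (fun i => ((Function.update z j t i : ℝ) : ℂ)) = ζ t := by
      intro t
      funext i
      by_cases h : i = j
      · subst h; simp [hζ]
      · simp [hζ, h]
    have := abs_integral_legendreKernel_sub_le (h := fun t => g (Function.update z j t))
      (hgm.comp (measurable_update z)) hp (fun t ht => by
        rw [hg, Set.indicator_of_mem (update_mem_cube hz j ht), hzt, abs_sub_comm]
        exact hpa t (Set.Ioo_subset_Icc_self ht)) (hz j)
    simp only [Function.update_eq_self] at this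
    refine this.trans_eq ?_
    ring

/-- Absorbs the polynomial losses into an arbitrarily small part of the exponential rate. -/
theorem exists_one_add_mul_pow_le_mul_exp {B δ : ℝ} (hB : 0 ≤ B) (hδ : 0 < δ) (m : ℕ) :
    ∃ C : ℝ, 0 < C ∧ ∀ u, 0 ≤ u → (1 + B * u) ^ m ≤ C * Real.exp (δ * u) := by
  set η := δ / (m + 1) with hη
  have hη0 : 0 < η := by positivity
  refine ⟨(1 + B / η) ^ m, by positivity, fun u hu => ?_⟩
  have h1 : 1 + B * u ≤ (1 + B / η) * Real.exp (η * u) := by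
    have h2 := Real.add_one_le_exp (η * u)
    have h3 : 0 ≤ η * u := by positivity
    have h4 : B * u = B / η * (η * u) := by field_simp
    rw [h4, add_mul, one_mul]
    have : B / η * (η * u) ≤ B / η * Real.exp (η * u) := by
      gcongr
      linarith
    linarith
  calc (1 + B * u) ^ m ≤ ((1 + B / η) * Real.exp (η * u)) ^ m := by gcongr
    _ = (1 + B / η) ^ m * Real.exp (m * (η * u)) := by rw [mul_pow, Real.exp_nat_mul]
    _ ≤ _ := by
      have hm : (m : ℝ) * η ≤ δ := by
        rw [hη, mul_div_assoc', div_le_iff₀ (by positivity)]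
        linarith
      rw [← mul_assoc]
      gcongr

/-- From `d! ≤ d ^ d`: the rate attained by boxes strictly exceeds the one required. -/
theorem inv_mul_factorial_mul_rpow_lt {d : ℕ} (hd : 1 ≤ d) {P : ℝ} (hP : 0 < P) :
    ((d : ℝ) + 1)⁻¹ * ((d ! : ℝ) * P) ^ (1 / (d : ℝ)) < P ^ (1 / (d : ℝ)) := by
  have hd0 : (d : ℝ) ≠ 0 := by positivity
  have h1 : ((d ! : ℝ)) ^ (1 / (d : ℝ)) ≤ d := by
    calc ((d ! : ℝ)) ^ (1 / (d : ℝ)) ≤ ((d : ℝ) ^ d) ^ (1 / (d : ℝ)) := by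
          gcongr
          exact_mod_cast Nat.factorial_le_pow d
      _ = d := by
          rw [one_div, Real.pow_rpow_inv_natCast (by positivity) (by omega)]
  rw [Real.mul_rpow (by positivity) hP.le, ← mul_assoc]
  refine mul_lt_of_lt_one_left (by positivity) ?_
  rw [inv_mul_lt_iff₀ (by positivity)]
  linarith

end Main

end LegendreApprox

/-! ### Choice of the boxes and the final estimate. -/

open LegendreApprox in
theorem theorem5p1 (d : ℕ) (hd : 1 ≤ d) (ρ : Fin d → ℝ) (hρ : ∀ j, 1 < ρ j)
    (f : (Fin d → ℝ) → ℝ) (hf : LegendreApprox.HasHolomorphicExtension ρ f) :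
    ∃ Λ : ℕ → Finset (Fin d → ℕ),
      (∀ s : ℕ, 1 ≤ s → IsLowerSet (Λ s : Set (Fin d → ℕ)) ∧ (Λ s).card ≤ s) ∧
      ∀ γ : ℝ, 0 < γ →
        γ < ((d : ℝ) + 1)⁻¹ * ((d ! : ℝ) * ∏ j, Real.log (ρ j)) ^ (1 / (d : ℝ)) →
        ∃ C : ℝ, 0 < C ∧ ∀ s : ℕ, 1 ≤ s →
          eLpNorm (fun x => f x - LegendreApprox.truncatedExpansion f (Λ s) x) ∞
              (LegendreApprox.uniformMeasure d) ≤
            ENNReal.ofReal (C * Real.exp (-γ * (s : ℝ) ^ (1 / (d : ℝ)))) := by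
  set P := ∏ j, Real.log (ρ j) with hPdef
  have ha : ∀ j, 0 < Real.log (ρ j) := fun j => Real.log_pos (hρ j)
  have hP : 0 < P := Finset.prod_pos fun j _ => ha j
  -- Chosen so that the side lengths `u s / log ρ_j` have product exactly `s`; rounding down keeps
  -- the cardinality at most `s`, and the box may be empty.
  let u : ℕ → ℝ := fun s => ((s : ℝ) * P) ^ (1 / (d : ℝ))
  have hu : ∀ s, 0 ≤ u s := fun s => by positivity
  let N : ℕ → Fin d → ℕ := fun s j => ⌊u s / Real.log (ρ j)⌋₊
  have hN : ∀ s j, (N s j : ℝ) ≤ u s / Real.log (ρ j) := fun s j =>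
    Nat.floor_le (div_nonneg (hu s) (ha j).le)
  refine ⟨fun s => Fintype.piFinset fun j => Finset.range (N s j), fun s _ => ⟨?_, ?_⟩, ?_⟩
  · intro ν μ hμν hν
    simp only [Finset.mem_coe, Fintype.mem_piFinset, Finset.mem_range] at hν ⊢
    exact fun j => (hμν j).trans_lt (hν j)
  · have : ((Fintype.piFinset fun j => Finset.range (N s j)).card : ℝ) ≤ s := by
      rw [Fintype.card_piFinset]
      push_cast
      simp only [Finset.card_range]
      calc ∏ j, (N s j : ℝ) ≤ ∏ j, u s / Real.log (ρ j) :=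
            Finset.prod_le_prod (fun _ _ => Nat.cast_nonneg _) fun j _ => hN s j
        _ = u s ^ d / P := by simp [Finset.prod_div_distrib, hPdef]
        _ = s := by
          simp only [u]
          rw [one_div, Real.rpow_inv_natCast_pow (by positivity) (by omega)]
          field_simp
    exact_mod_cast this
  · intro γ hγ hγlt
    obtain ⟨c, hc, herr⟩ := exists_error_bound_piFinset hρ hf
    have hQ : 0 < P ^ (1 / (d : ℝ)) := by positivity
    -- The target exponent is `θ u` with `θ < 1`, which leaves `(1 - θ) u` to absorb the powers of
    -- `1 + B u`.
    set θ := γ / P ^ (1 / (d : ℝ)) with hθ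
    have hθ1 : θ < 1 := (div_lt_one hQ).2 (hγlt.trans (inv_mul_factorial_mul_rpow_lt hd hP))
    have hθu : ∀ s : ℕ, γ * (s : ℝ) ^ (1 / (d : ℝ)) = θ * u s := by
      intro s
      simp only [u, hθ]
      rw [Real.mul_rpow (by positivity) hP.le]
      field_simp
    set B := ∑ j, (Real.log (ρ j))⁻¹
    have hB : 0 ≤ B := Finset.sum_nonneg fun j _ => (inv_pos.2 (ha j)).le
    -- The exponent counts one square for each of the `d` kernel bounds and one for the one-variable
    -- error.
    obtain ⟨C, hC, hCu⟩ := exists_one_add_mul_pow_le_mul_exp hB (sub_pos.2 hθ1) (2 * d + 2)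
    set D := ∑ j, c j * ρ j
    have hD : 0 ≤ D := Finset.sum_nonneg fun j _ =>
      mul_nonneg (hc j) (zero_le_one.trans (hρ j).le)
    refine ⟨(D + 1) * C, by positivity, fun s _ => ?_⟩
    have hbound : ∀ x ∈ cube d,
        ‖f x - truncatedExpansion f (Fintype.piFinset fun j => Finset.range (N s j)) x‖ ≤
          (D + 1) * C * Real.exp (-γ * (s : ℝ) ^ (1 / (d : ℝ))) := by
      intro x hx
      have h1 : ∀ j, 1 + (N s j : ℝ) ≤ 1 + B * u s := by
        intro j
        refine add_le_add le_rfl ((hN s j).trans ?_)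
        rw [div_eq_inv_mul]
        exact mul_le_mul_of_nonneg_right (Finset.single_le_sum
          (f := fun j => (Real.log (ρ j))⁻¹) (fun j _ => (inv_pos.2 (ha j)).le)
          (Finset.mem_univ j)) (hu s)
      -- The factor `ρ j` is the cost of rounding down.
      have h2 : ∀ j, (ρ j)⁻¹ ^ N s j ≤ ρ j * Real.exp (-u s) := by
        intro j
        have hρ0 : 0 < ρ j := zero_lt_one.trans (hρ j)
        have h3 : u s < (N s j + 1) * Real.log (ρ j) := by
          rw [← div_lt_iff₀ (ha j)]
          exact Nat.lt_floor_add_one _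
        calc (ρ j)⁻¹ ^ N s j = Real.exp (-(N s j * Real.log (ρ j))) := by
              rw [Real.exp_neg, Real.exp_nat_mul, Real.exp_log hρ0, inv_pow]
          _ ≤ Real.exp (Real.log (ρ j) + -u s) := Real.exp_le_exp.2 (by linarith)
          _ = _ := by rw [Real.exp_add, Real.exp_log hρ0]
      have hBu : 0 ≤ 1 + B * u s := by have := hu s; positivity
      calc _ ≤ (∏ j, (1 + (N s j : ℝ)) ^ 2) *
              ∑ j, (1 + (N s j : ℝ)) ^ 2 * (c j * (ρ j)⁻¹ ^ N s j) := herr _ x hx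
        _ ≤ (∏ _j : Fin d, (1 + B * u s) ^ 2) *
              ∑ j, (1 + B * u s) ^ 2 * (c j * (ρ j * Real.exp (-u s))) := by
            have hρ0 : ∀ j, 0 < ρ j := fun j => zero_lt_one.trans (hρ j)
            refine mul_le_mul (Finset.prod_le_prod (fun j _ => by positivity) fun j _ => ?_)
              (Finset.sum_le_sum fun j _ => ?_) (Finset.sum_nonneg fun j _ => ?_) (by positivity)
            · exact pow_le_pow_left₀ (by positivity) (h1 j) 2
            · have := hc j
              have := hρ0 j
              exact mul_le_mul (pow_le_pow_left₀ (by positivity) (h1 j) 2)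
                (mul_le_mul_of_nonneg_left (h2 j) (hc j)) (by positivity) (by positivity)
            · have := hc j
              have := hρ0 j
              positivity
        _ = D * Real.exp (-u s) * (1 + B * u s) ^ (2 * d + 2) := by
            simp only [Finset.prod_const, Finset.card_univ, Fintype.card_fin, D, Finset.sum_mul,
              Finset.mul_sum]
            refine Finset.sum_congr rfl fun j _ => ?_
            generalize 1 + B * u s = v
            ring
        _ ≤ (D + 1) * Real.exp (-u s) * (C * Real.exp ((1 - θ) * u s)) := by
            gcongr
            · linarith
            · exact hCu _ (hu s)
        _ = (D + 1) * C * Real.exp (-γ * (s : ℝ) ^ (1 / (d : ℝ))) := by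
            rw [neg_mul, hθu, mul_mul_mul_comm, ← Real.exp_add]
            congr 2
            ring
    rw [eLpNorm_exponent_top]
    exact eLpNormEssSup_le_of_ae_bound ((ae_mem_cube d).mono hbound)
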